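/- Let $K$ be a class of partial functions with natural arguments and values, of arbitrary positive arities. Consider the following conditions. 1. (Closure) $K$ contains all partial recursive functions and is closed under substitution, primitive recursion and the $\mu$-operator. 2. (Computation records) For every unary $f\in K$ there are a set $M\subseteq\mathbb N$ and unary $\alpha,\omega\in K$ whose domains contain $M$ such that the indicator function of $M$ belongs to $K$ and, for all $x,y$, $f(x)$ is defined and equal to $y$ if and only if there is $m\in M$ with $\alpha(m)=x$ and $\omega(m)=y$. 3. (Programs) There is a binary $F\in K$ such that every unary $f\in K$ equals $F(n,\cdot)$ for some $n$. A set $Y$ is enumeration reducible to $X$ if $Y=\Phi_W(X)$ for some recursively enumerable set $W$ of pairs (finite set, element), where $\Phi_W(X)=\{b : (D,b)\in W \text{ for some finite } D\subseteq X\}$; the maps $\Phi_W$ are the enumeration operators (tuples are coded by numbers). Call $K$ *relativized* if there is a set $A\subseteq\mathbb N$ such that $K$ is the class of all functions that are partial recursive relative to $A$, and *e-relativized* if there is a set $A\subseteq\mathbb N$ such that $K$ is the class of all functions whose graph is enumeration reducible to the graph of the indicator function of $A$. All three conditions are essential, as the following three examples show. (a) Let $K$ consist of the unary identity function, the (total)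 unary constant functions, and all partial functions of arity $\ge 2$. Then $K$ satisfies 2 and 3, but not 1, and $K$ is neither relativized nor e-relativized. (b) There is a partial function $\psi:\mathbb N\rightharpoonup\mathbb N$ that is not partial recursive and such that every total function $g:\mathbb N\to\mathbb N$ whose graph is enumeration reducible to the graph of $\psi$ is recursive. For every such $\psi$, let $K$ be the class of all functions $\Psi(\psi)$, where $\Psi$ is a recursive operator, that is, a map from all unary partial functions to partial functions of some fixed arity for which there is an enumeration operator $\Phi$ such that, for every $\varphi$, $\Phi$ takes the graph of $\varphi$ to the graph of $\Psi(\varphi)$. Then $K$ satisfies 1 and 3, but not 2, and $K$ is neither relativized nor e-relativized. (c) Let $K$ consist of all partial functions. Then $K$ satisfies 1 and 2, but not 3, and $K$ is neither relativized nor e-relativized. -/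

import Mathlib

namespace RelComp

/-- A class of partial functions with natural arguments and values, of arbitrary positive arity:
`K n` is the set of those members of the class that have `n + 1` arguments. -/
abbrev FunClass : Type := (n : ℕ) → Set ((Fin (n + 1) → ℕ) →. ℕ)

/-- A partial function `ℕ →. ℕ` as a function of one-element tuples. -/
def unary (f : ℕ →. ℕ) : (Fin 1 → ℕ) →. ℕ := fun v => f (v 0)

/-- A binary partial function as a function of two-element tuples. -/
def binary (F : ℕ → ℕ →. ℕ) : (Fin 2 → ℕ) →. ℕ := fun v => F (v 0) (v 1)

/-- The indicator function of a set of natural numbers, as an (everywhere defined) partial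
function: `1` on the set and `0` outside. -/
noncomputable def indicatorFun (M : Set ℕ) : ℕ →. ℕ :=
  fun n => Part.some (M.indicator (fun _ => 1) n)

/-! ### Closure properties -/

/-- The substitution `v ↦ f (g 0 v, …, g m v)`; it is defined at `v` if and only if all `g i v`
are defined and `f` is defined at the tuple of their values. -/
def subst {n m : ℕ} (f : (Fin (m + 1) → ℕ) →. ℕ) (g : Fin (m + 1) → (Fin (n + 1) → ℕ) →. ℕ) :
    (Fin (n + 1) → ℕ) →. ℕ :=
  fun v => Part.bind ⟨∀ i, (g i v).Dom, fun h i => (g i v).get (h i)⟩ f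

/-- Primitive recursion with parameters:
`h (0, v) = f v` and `h (y + 1, v) = g (y, h (y, v), v)`. -/
def primRec {n : ℕ} (f : (Fin (n + 1) → ℕ) →. ℕ) (g : (Fin (n + 3) → ℕ) →. ℕ) :
    (Fin (n + 2) → ℕ) →. ℕ :=
  fun w => Nat.rec (motive := fun _ => Part ℕ) (f (Fin.tail w))
    (fun y ih => ih.bind fun z =>
      g (Fin.cons y (Fin.cons z (Fin.tail w : Fin (n + 1) → ℕ) : Fin (n + 2) → ℕ)))
    (w 0)

/-- Primitive recursion without parameters: `h 0 = c` and `h (y + 1) = g (y, h y)`. -/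
def primRec₀ (c : ℕ) (g : (Fin 2 → ℕ) →. ℕ) : (Fin 1 → ℕ) →. ℕ :=
  fun w => Nat.rec (motive := fun _ => Part ℕ) (Part.some c)
    (fun y ih => ih.bind fun z => g ![y, z]) (w 0)

/-- The `μ`-operator: the least `y` such that `f (y, v) = 0`, where `f (z, v)` is required to be
defined for all `z < y`. -/
def mu {n : ℕ} (f : (Fin (n + 2) → ℕ) →. ℕ) : (Fin (n + 1) → ℕ) →. ℕ :=
  fun v => Nat.rfind fun y =>
    (f (Fin.cons y v : Fin (n + 2) → ℕ)).map fun z => decide (z = 0)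

/-- The class contains all partial recursive functions and is closed under substitution,
primitive recursion and the `μ`-operator. -/
structure ClosureProperties (K : FunClass) : Prop where
  partrec : ∀ {n : ℕ} (f : (Fin (n + 1) → ℕ) →. ℕ), Partrec f → f ∈ K n
  subst : ∀ {n m : ℕ} (f : (Fin (m + 1) → ℕ) →. ℕ) (g : Fin (m + 1) → (Fin (n + 1) → ℕ) →. ℕ),
    f ∈ K m → (∀ i, g i ∈ K n) → RelComp.subst f g ∈ K n
  primRec : ∀ {n : ℕ} (f : (Fin (n + 1) → ℕ) →. ℕ) (g : (Fin (n + 3) → ℕ) →. ℕ),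
    f ∈ K n → g ∈ K (n + 2) → RelComp.primRec f g ∈ K (n + 1)
  primRec₀ : ∀ (c : ℕ) (g : (Fin 2 → ℕ) →. ℕ), g ∈ K 1 → RelComp.primRec₀ c g ∈ K 0
  mu : ∀ {n : ℕ} (f : (Fin (n + 2) → ℕ) →. ℕ), f ∈ K (n + 1) → RelComp.mu f ∈ K n

/-! ### The axioms of computation records and of programs -/

/-- The axiom of computation records. -/
def ComputationRecords (K : FunClass) : Prop :=
  ∀ f : ℕ →. ℕ, unary f ∈ K 0 →
    ∃ (M : Set ℕ) (α ω : ℕ →. ℕ), unary α ∈ K 0 ∧ unary ω ∈ K 0 ∧ M ⊆ α.Dom ∧ M ⊆ ω.Dom ∧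
      unary (indicatorFun M) ∈ K 0 ∧
      ∀ x y : ℕ, y ∈ f x ↔ ∃ m ∈ M, x ∈ α m ∧ y ∈ ω m

/-- The programs axiom: some binary function of the class is universal for the unary functions
of the class. -/
def ProgramsAxiom (K : FunClass) : Prop :=
  ∃ F : ℕ → ℕ →. ℕ, binary F ∈ K 1 ∧ ∀ f : ℕ →. ℕ, unary f ∈ K 0 → ∃ n, F n = f

/-! ### Enumeration operators, enumeration reducibility, recursive operators -/

/-- The enumeration operator given by a set `W` of pairs (finite set, element), the finite sets
being presented by lists. -/
def enumOperator {α β : Type} (W : Set (List α × β)) (X : Set α) : Set β :=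
  {b | ∃ D : List α, (D, b) ∈ W ∧ ∀ a ∈ D, a ∈ X}

/-- `Y` is enumeration reducible to `X`: it is the image of `X` under the enumeration operator
given by some recursively enumerable set. -/
def EnumReducible {α β : Type} [Primcodable α] [Primcodable β] (Y : Set β) (X : Set α) : Prop :=
  ∃ W : Set (List α × β), REPred (fun p => p ∈ W) ∧ Y = enumOperator W X

/-- A recursive operator: a mapping defined on all unary partial functions, with partial
functions as values, that acts on graphs as an enumeration operator. -/
def IsRecursiveOperator {n : ℕ} (Ψ : (ℕ →. ℕ) → ((Fin (n + 1) → ℕ) →. ℕ)) : Prop :=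
  ∃ W : Set (List (ℕ × ℕ) × ((Fin (n + 1) → ℕ) × ℕ)), REPred (fun p => p ∈ W) ∧
    ∀ φ : ℕ →. ℕ, (Ψ φ).graph = enumOperator W φ.graph

/-- `ψ` is not partial recursive, but every total function enumeration reducible to `ψ` is
recursive. -/
def IsQuasiMinimal (ψ : ℕ →. ℕ) : Prop :=
  ¬ Partrec ψ ∧
    ∀ g : ℕ → ℕ, EnumReducible (g : ℕ →. ℕ).graph ψ.graph → Computable g

/-! ### Relativized classes -/

/-- `K` is the class of all functions that are partial recursive relative to some oracle set. -/
def IsRelativized (K : FunClass) : Prop :=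
  ∃ A : Set ℕ, ∀ (n : ℕ) (f : (Fin (n + 1) → ℕ) →. ℕ), f ∈ K n ↔ RecursiveIn {indicatorFun A} f

/-- `K` is, for some set `A`, the class of all functions whose graph is enumeration reducible to
the graph of the indicator function of `A`. -/
def IsEnumRelativized (K : FunClass) : Prop :=
  ∃ A : Set ℕ, ∀ (n : ℕ) (f : (Fin (n + 1) → ℕ) →. ℕ),
    f ∈ K n ↔ EnumReducible f.graph (indicatorFun A).graph

/-! ### The three classes -/

/-- The unary identity function, the unary constant functions, and all functions of arity `≥ 2`. -/
def idConstClass : FunClass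
  | 0 => {f | f = unary (fun x => Part.some x) ∨ ∃ c : ℕ, f = unary (fun _ => Part.some c)}
  | _ + 1 => Set.univ

/-- All functions that can be obtained from `ψ` by recursive operators. -/
def operatorClass (ψ : ℕ →. ℕ) : FunClass :=
  fun _ => {f | ∃ Ψ, IsRecursiveOperator Ψ ∧ f = Ψ ψ}

/-- All partial functions. -/
def allFunctions : FunClass := fun _ => Set.univ

end RelComp

/-! Examples (a) and (c) are elementary. In (a) the missing successor function refutes closure and
both forms of relativization, while a universal binary function costs nothing because every binary
function is in the class. In (c) diagonalization refutes the programs axiom, and both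
relativizations fail by cardinality: one oracle yields only countably many functions.

The weight lies in (b). Closure rests on the calculus of `UniformEnum`: relations enumerated from
the graph of `φ` by one operator, the same for all `φ`, are closed under conjunction, existential
quantification and bounded universal quantification, and substitution, recursion and `μ` are
expressible in this way. For the programs axiom, all r.e. sets of axioms are listed and an axiom is
discarded if it conflicts with an earlier one. Every resulting operator is single-valued on partial
functions, and a set that already defines a recursive operator loses nothing (`universalRel_unique`,
`exists_universalRel_iff`).

A quasi-minimal `ψ` is the semicharacteristic function of a Baire-generic set `A`. If `W` enumerates
a total function from `A`, genericity gives a finite initial segment of `A` no extension of which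
makes `W` multivalued. Filling `A` up beyond this segment yields a cofinite set from which `W`
enumerates the same function, which is therefore recursive. Finally, all total functions in the
class of such a `ψ` are recursive. An oracle indicator in the class, or the total data of
computation records for `ψ`, would thus make `ψ` partial recursive. -/

namespace RelComp

/-! ### Recursively enumerable predicates: stages and closure properties -/

section RecursivelyEnumerable

variable {α β γ : Type*} [Primcodable α] [Primcodable β] [Primcodable γ]

open Nat.Partrec (Code)
open Encodable

theorem exists_code_of_rePred {p : α → Prop} (hp : REPred p) :
    ∃ c : Code, ∀ n, (c.eval n).Dom ↔ ∃ a ∈ (decode n : Option α), p a := by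
  obtain ⟨c, hc⟩ := Code.exists_code.1 hp
  refine ⟨c, fun n => ?_⟩
  rw [hc]
  simp [Part.dom_iff_mem]

theorem exists_code_of_rePred_encode {p : α → Prop} (hp : REPred p) :
    ∃ c : Code, ∀ a, p a ↔ (c.eval (encode a)).Dom := by
  obtain ⟨c, hc⟩ := exists_code_of_rePred hp
  exact ⟨c, fun a => by simp [hc]⟩

/-- A recursively enumerable predicate is the increasing union of a primitive recursive sequence
of predicates. -/
theorem exists_primrecRel_of_rePred {p : α → Prop} (hp : REPred p) :
    ∃ q : α → ℕ → Prop, PrimrecRel q ∧ (∀ a k l, k ≤ l → q a k → q a l) ∧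
      ∀ a, p a ↔ ∃ k, q a k := by
  obtain ⟨c, hc⟩ := exists_code_of_rePred_encode hp
  refine ⟨fun a k => (Code.evaln k c (encode a)).isSome = true, ?_, ?_, fun a => ?_⟩
  · exact PrimrecRel.comp (R := fun x y : Bool => x = y) Primrec.eq
      (Primrec.option_isSome.comp
        (Code.primrec_evaln.comp
          (Primrec.pair (Primrec.pair Primrec.snd (Primrec.const c))
            (Primrec.encode.comp Primrec.fst))))
      (Primrec.const true)
  · intro a k l hkl h
    obtain ⟨x, hx⟩ := Option.isSome_iff_exists.1 h
    exact Option.isSome_iff_exists.2 ⟨x, Code.evaln_mono hkl hx⟩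
  · rw [hc, Part.dom_iff_mem]
    simp only [Code.evaln_complete, Option.isSome_iff_exists]
    exact exists_comm

theorem rePred_of_primrecPred {p : α → Prop} (hp : PrimrecPred p) : REPred p :=
  ComputablePred.to_re (ComputablePred.computable_iff.2 <| by
    obtain ⟨_, h⟩ := hp
    exact ⟨_, h.to_comp, by ext; simp⟩)

theorem rePred_comp {p : β → Prop} (hp : REPred p) {f : α → β} (hf : Computable f) :
    REPred fun a => p (f a) :=
  Partrec.comp hp hf

theorem rePred_and {p q : α → Prop} (hp : REPred p) (hq : REPred q) :
    REPred fun a => p a ∧ q a := by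
  have := Partrec.dom_re (Partrec.bind hp (Partrec.comp hq Computable.fst).to₂)
  refine this.of_eq fun a => ?_
  simp [Part.assert]

theorem rePred_exists_nat {q : α → ℕ → Prop} (hq : PrimrecRel q) :
    REPred fun a => ∃ k, q a k := by
  classical
  obtain ⟨d, hq⟩ := hq
  refine (Partrec.dom_re (Partrec.rfind (p := fun a k => Part.some (decide (q a k)))
    ?_)).of_eq fun a => ?_
  · exact (hq.to_comp.of_eq fun _ => by simp).partrec
  · exact ⟨fun h => ⟨_, of_decide_eq_true (Part.mem_some_iff.1 (Nat.rfind_dom.1 h).choose_spec.1).symm⟩,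
      fun ⟨k, hk⟩ => Nat.rfind_dom.2 ⟨k, by simpa using hk, fun _ => trivial⟩⟩

/-- Dovetailing: the search runs over pairs of a code for the witness and a stage confirming it. -/
theorem rePred_exists {p : α × γ → Prop} (hp : REPred p) : REPred fun a => ∃ c, p (a, c) := by
  have h1 : REPred fun x : α × ℕ => ∃ c ∈ (decode x.2 : Option γ), p (x.1, c) := by
    have := Partrec.bind (f := fun x : α × ℕ => ((decode x.2 : Option γ) : Part γ))
      (Computable.ofOption (Computable.decode.comp Computable.snd))
      (g := fun x c => Part.assert (p (x.1, c)) fun _ => Part.some ())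
      (Partrec.comp hp (Computable.pair (Computable.fst.comp Computable.fst) Computable.snd))
    refine (Partrec.dom_re this).of_eq fun x => ?_
    simp [Part.dom_iff_mem]
  obtain ⟨q, hq, -, h⟩ := exists_primrecRel_of_rePred h1
  have h2 : PrimrecRel fun (a : α) (n : ℕ) => q (a, n.unpair.1) n.unpair.2 :=
    hq.comp (Primrec.pair Primrec.fst (Primrec.fst.comp (Primrec.unpair.comp Primrec.snd)))
      (Primrec.snd.comp (Primrec.unpair.comp Primrec.snd))
  refine (rePred_exists_nat h2).of_eq fun a => ⟨?_, ?_⟩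
  · rintro ⟨n, hn⟩
    obtain ⟨c, -, hc⟩ := (h _).2 ⟨_, hn⟩
    exact ⟨c, hc⟩
  · rintro ⟨c, hc⟩
    obtain ⟨k, hk⟩ := (h (a, encode c)).1 ⟨c, by simp, hc⟩
    exact ⟨Nat.pair (encode c) k, by simpa using hk⟩

/-- Stages are monotone, so finitely many confirmations share a common stage, and a primitive
recursive test at that stage suffices. -/
theorem rePred_forall_mem_list {p : α → Prop} (hp : REPred p) :
    REPred fun l : List α => ∀ a ∈ l, p a := by
  obtain ⟨q, hq, hmono, h⟩ := exists_primrecRel_of_rePred hp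
  refine (rePred_exists_nat hq.forall_mem_list).of_eq fun l => ?_
  simp only [h]
  induction l with
  | nil => simp
  | cons a l ih =>
    simp only [List.mem_cons, forall_eq_or_imp, ← ih]
    constructor
    · rintro ⟨k, h1, h2⟩
      exact ⟨⟨k, h1⟩, k, h2⟩
    · rintro ⟨⟨k, h1⟩, m, h2⟩
      exact ⟨max k m, hmono _ _ _ (le_max_left _ _) h1,
        fun b hb => hmono _ _ _ (le_max_right _ _) (h2 b hb)⟩

theorem rePred_graph {f : α →. ℕ} (hf : Partrec f) : REPred fun p => p ∈ f.graph := by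
  have h1 : REPred fun x : (α × ℕ) × ℕ => x.2 = x.1.2 :=
    rePred_of_primrecPred (Primrec.eq.comp Primrec.snd (Primrec.snd.comp Primrec.fst))
  have := Partrec.dom_re (Partrec.bind (hf.comp Computable.fst) h1.to₂)
  refine this.of_eq fun a => ?_
  simp only [Part.dom_iff_mem, Part.mem_bind_iff, Part.mem_assert_iff, Part.mem_some_iff,
    PFun.graph, Set.mem_ofPred_eq]
  exact ⟨fun ⟨_, z, hz, e, _⟩ => e ▸ hz, fun h => ⟨(), _, h, rfl, trivial⟩⟩

/-- One searches for a pair (value, stage); since `f` is single-valued, whichever pair is found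
first carries the right value. -/
theorem partrec_of_rePred_graph {f : α →. ℕ} (hf : REPred fun p => p ∈ f.graph) :
    Partrec f := by
  classical
  obtain ⟨q, ⟨_, hq⟩, -, h⟩ := exists_primrecRel_of_rePred hf
  have h1 : Computable fun x : α × ℕ => decide (q (x.1, x.2.unpair.1) x.2.unpair.2) :=
    ((hq.comp (Primrec.pair
      (Primrec.pair Primrec.fst (Primrec.fst.comp (Primrec.unpair.comp Primrec.snd)))
      (Primrec.snd.comp (Primrec.unpair.comp Primrec.snd)))).to_comp).of_eq fun _ => by simp
  have h2 := Partrec.map (Partrec.rfind (p := fun a n =>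
      Part.some (decide (q (a, n.unpair.1) n.unpair.2))) h1.partrec)
    (g := fun _ n => n.unpair.1)
    (Computable.fst.comp (Computable.unpair.comp Computable.snd)).to₂
  have key : ∀ a (n : ℕ), q (a, n.unpair.1) n.unpair.2 → n.unpair.1 ∈ f a := fun a n hn =>
    (h (a, n.unpair.1)).2 ⟨_, hn⟩
  refine h2.of_eq fun a => Part.ext fun y => ?_
  simp only [Part.mem_map_iff]
  constructor
  · rintro ⟨n, hn, rfl⟩
    exact key a n (by simpa using Nat.rfind_spec hn)
  · intro hy
    obtain ⟨k, hk⟩ := (h (a, y)).1 hy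
    obtain ⟨n, hn, -⟩ := Nat.rfind_min' (p := fun n => decide (q (a, n.unpair.1) n.unpair.2))
      (m := Nat.pair y k) (by simpa using hk)
    exact ⟨n, hn, Part.mem_unique (key a n (by simpa using Nat.rfind_spec hn)) hy⟩

theorem countable_setOf_rePred : {W : Set α | REPred fun a => a ∈ W}.Countable := by
  refine (Set.countable_range fun c : Code => {a : α | (c.eval (encode a)).Dom}).mono ?_
  intro W hW
  obtain ⟨c, hc⟩ := exists_code_of_rePred_encode hW
  exact ⟨c, Set.ext fun a => (hc a).symm⟩

end RecursivelyEnumerable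

/-! ### Uniform enumeration -/

section UniformEnum

variable {ι α β γ : Type} [Primcodable α] [Primcodable β] [Primcodable γ]

/-- A family of predicates is enumerated from a family of sets by one enumeration operator. -/
def UniformEnum (G : ι → Set α) (P : ι → β → Prop) : Prop :=
  ∃ W : Set (List α × β), REPred (fun p => p ∈ W) ∧ ∀ i b, P i b ↔ b ∈ enumOperator W (G i)

variable {G : ι → Set α}

theorem primrecRel_list_subset :
    PrimrecRel fun D E : List α => ∀ a ∈ D, a ∈ E := by
  have h1 : PrimrecRel fun (E : List α) (a : α) => ∃ b ∈ E, b = a :=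
    PrimrecRel.exists_mem_list Primrec.eq
  have h2 : PrimrecRel fun (a : α) (E : List α) => ∃ b ∈ E, b = a :=
    h1.comp Primrec.snd Primrec.fst
  refine PrimrecPred.of_eq h2.forall_mem_list fun _ => ?_
  simp

namespace UniformEnum

theorem of_iff {P Q : ι → β → Prop} (hP : UniformEnum G P) (h : ∀ i b, P i b ↔ Q i b) :
    UniformEnum G Q := by
  obtain ⟨W, hW, hWP⟩ := hP
  exact ⟨W, hW, fun i b => (h i b).symm.trans (hWP i b)⟩

theorem of_rePred {p : β → Prop} (hp : REPred p) : UniformEnum G fun _ b => p b := by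
  refine ⟨{x | x.1 = [] ∧ p x.2}, rePred_and (rePred_of_primrecPred
    (Primrec.eq.comp Primrec.fst (Primrec.const []))) (rePred_comp hp Computable.snd), ?_⟩
  intro i b
  simp [enumOperator]

theorem base : UniformEnum G fun i a => a ∈ G i := by
  refine ⟨{x | x.1 = [x.2]}, rePred_of_primrecPred
    (Primrec.eq.comp Primrec.fst (Primrec.list_cons.comp Primrec.snd (Primrec.const []))), ?_⟩
  intro i b
  simp [enumOperator]

theorem comp {P : ι → γ → Prop} (hP : UniformEnum G P) {f : β → γ} (hf : Computable f) :
    UniformEnum G fun i b => P i (f b) := by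
  obtain ⟨W, hW, h⟩ := hP
  refine ⟨{x | (x.1, f x.2) ∈ W},
    rePred_comp hW (Computable.pair Computable.fst (hf.comp Computable.snd)), ?_⟩
  intro i b
  simp [enumOperator, h]

/-- Premises of the two axioms are concatenated. -/
theorem and {P Q : ι → β → Prop} (hP : UniformEnum G P) (hQ : UniformEnum G Q) :
    UniformEnum G fun i b => P i b ∧ Q i b := by
  obtain ⟨V, hV, hVP⟩ := hP
  obtain ⟨W, hW, hWQ⟩ := hQ
  refine ⟨{x | ∃ d : List α × List α, (x.1 = d.1 ++ d.2 ∧ (d.1, x.2) ∈ V) ∧ (d.2, x.2) ∈ W},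
    ?_, ?_⟩
  · refine rePred_exists (γ := List α × List α) (p := fun y : (List α × β) × (List α × List α) =>
      (y.1.1 = y.2.1 ++ y.2.2 ∧ (y.2.1, y.1.2) ∈ V) ∧ (y.2.2, y.1.2) ∈ W) ?_
    refine rePred_and (rePred_and (rePred_of_primrecPred ?_)
      (rePred_comp hV (Primrec.to_comp ?_))) (rePred_comp hW (Primrec.to_comp ?_))
    · exact Primrec.eq.comp (Primrec.fst.comp Primrec.fst)
        (Primrec.list_append.comp (Primrec.fst.comp Primrec.snd) (Primrec.snd.comp Primrec.snd))
    · exact Primrec.pair (Primrec.fst.comp Primrec.snd) (Primrec.snd.comp Primrec.fst)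
    · exact Primrec.pair (Primrec.snd.comp Primrec.snd) (Primrec.snd.comp Primrec.fst)
  · intro i b
    simp only [hVP, hWQ, enumOperator, Set.mem_ofPred_eq]
    constructor
    · rintro ⟨⟨D, hD, hD'⟩, E, hE, hE'⟩
      exact ⟨D ++ E, ⟨(D, E), ⟨rfl, hD⟩, hE⟩, by simpa [or_imp, forall_and] using ⟨hD', hE'⟩⟩
    · rintro ⟨_, ⟨⟨D, E⟩, ⟨rfl, hD⟩, hE⟩, h⟩
      exact ⟨⟨D, hD, fun a ha => h a (List.mem_append_left _ ha)⟩,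
        E, hE, fun a ha => h a (List.mem_append_right _ ha)⟩

theorem exists' {P : ι → β × γ → Prop} (hP : UniformEnum G P) :
    UniformEnum G fun i b => ∃ c, P i (b, c) := by
  obtain ⟨W, hW, h⟩ := hP
  refine ⟨{x | ∃ c, (x.1, (x.2, c)) ∈ W}, rePred_exists (p := fun y : (List α × β) × γ =>
    (y.1.1, (y.1.2, y.2)) ∈ W) (rePred_comp hW (Primrec.to_comp ?_)), ?_⟩
  · exact Primrec.pair (Primrec.fst.comp Primrec.fst)
      (Primrec.pair (Primrec.snd.comp Primrec.fst) Primrec.snd)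
  · intro i b
    simp only [h, enumOperator, Set.mem_ofPred_eq]
    exact ⟨fun ⟨c, D, h1, h2⟩ => ⟨D, ⟨c, h1⟩, h2⟩, fun ⟨D, ⟨c, h1⟩, h2⟩ => ⟨c, D, h1, h2⟩⟩

theorem forall_mem_list {P : ι → β → Prop} (hP : UniformEnum G P) :
    UniformEnum G fun i (l : List β) => ∀ b ∈ l, P i b := by
  obtain ⟨W, hW, h⟩ := hP
  have h1 : REPred fun y : List α × β => ∃ D : List α, (D, y.2) ∈ W ∧ ∀ a ∈ D, a ∈ y.1 := by
    refine rePred_exists (p := fun z : (List α × β) × List α =>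
      (z.2, z.1.2) ∈ W ∧ ∀ a ∈ z.2, a ∈ z.1.1) (rePred_and (rePred_comp hW (Primrec.to_comp ?_))
        (rePred_of_primrecPred ?_))
    · exact Primrec.pair Primrec.snd (Primrec.snd.comp Primrec.fst)
    · exact primrecRel_list_subset.comp Primrec.snd (Primrec.fst.comp Primrec.fst)
  -- A list `D` of premises serves for `l` when each member of `l` has an axiom of `W` with premises
  -- inside `D`.
  refine ⟨{x | ∀ y ∈ x.2.map fun b => (x.1, b), ∃ D : List α, (D, y.2) ∈ W ∧ ∀ a ∈ D, a ∈ y.1},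
    rePred_comp (rePred_forall_mem_list h1) (Primrec.to_comp ?_), ?_⟩
  · exact Primrec.list_map Primrec.snd (Primrec.pair (Primrec.fst.comp Primrec.fst) Primrec.snd)
  · intro i l
    simp only [h, enumOperator, Set.mem_ofPred_eq, List.mem_map, forall_exists_index, and_imp,
      forall_apply_eq_imp_iff₂]
    constructor
    · intro hl
      choose! D hD hD' using hl
      refine ⟨l.flatMap D, fun b hb => ⟨D b, hD b hb, fun a ha => ?_⟩, fun a ha => ?_⟩
      · exact List.mem_flatMap.2 ⟨b, hb, ha⟩
      · obtain ⟨b, hb, ha⟩ := List.mem_flatMap.1 ha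
        exact hD' b hb a ha
    · rintro ⟨D, h1, h2⟩ b hb
      obtain ⟨E, hE, hE'⟩ := h1 b hb
      exact ⟨E, hE, fun a ha => h2 a (hE' a ha)⟩

theorem forall_lt {P : ι → β × ℕ → Prop} (hP : UniformEnum G P) {f : β → ℕ}
    (hf : Primrec f) : UniformEnum G fun i b => ∀ k < f b, P i (b, k) := by
  refine (hP.forall_mem_list.comp (f := fun b => (List.range (f b)).map fun k => (b, k))
    (Primrec.to_comp ?_)).of_iff fun i b => by simp
  exact Primrec.list_map (Primrec.list_range.comp hf)
    (Primrec.pair Primrec.fst Primrec.snd)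

theorem forall_fin {m : ℕ} {P : Fin m → ι → β → Prop} (hP : ∀ j, UniformEnum G (P j)) :
    UniformEnum G fun i b => ∀ j, P j i b := by
  induction m with
  | zero =>
    exact (of_rePred (rePred_of_primrecPred (Primrec.eq.comp (Primrec.const 0)
      (Primrec.const 0)))).of_iff (P := fun _ _ => 0 = 0) fun i b => by simp
  | succ m ih =>
    exact ((hP 0).and (ih fun j => hP j.succ)).of_iff fun i b =>
      (Fin.forall_fin_succ (P := fun j => P j i b)).symm

theorem enumReducible {P : ι → β → Prop} (hP : UniformEnum G P) (i : ι) :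
    EnumReducible {b | P i b} (G i) := by
  obtain ⟨W, hW, h⟩ := hP
  exact ⟨W, hW, Set.ext (h i)⟩

end UniformEnum

theorem rePred_of_enumReducible {Y : Set β} {X : Set α} (h : EnumReducible Y X)
    (hX : REPred fun a => a ∈ X) : REPred fun b => b ∈ Y := by
  obtain ⟨W, hW, rfl⟩ := h
  refine rePred_exists (p := fun z : β × List α => (z.2, z.1) ∈ W ∧ ∀ a ∈ z.2, a ∈ X)
    (rePred_and (rePred_comp hW (Primrec.to_comp ?_))
      (rePred_comp (rePred_forall_mem_list hX) Computable.snd))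
  exact Primrec.pair Primrec.snd Primrec.fst

end UniformEnum

/-! ### Closure properties of the class of values of recursive operators -/

section OperatorClass

variable {α : Type} [Primcodable α]

theorem primrec_pi {n : ℕ} {f : α → Fin n → ℕ} (h : ∀ i, Primrec fun a => f a i) : Primrec f :=
  Primrec.fin_curry.2 (Primrec₂.swap (Primrec.fin_curry₁ (f := fun i a => f a i) |>.2 h))

theorem primrec_app {n : ℕ} {f : α → Fin n → ℕ} (hf : Primrec f) (i : Fin n) :
    Primrec fun a => f a i :=
  Primrec.fin_app.comp hf (Primrec.const i)

theorem primrec_fin_cons {n : ℕ} {f : α → ℕ} {g : α → Fin n → ℕ} (hf : Primrec f)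
    (hg : Primrec g) : Primrec fun a => (Fin.cons (f a) (g a) : Fin (n + 1) → ℕ) :=
  primrec_pi fun i => Fin.cases (by simpa using hf) (fun j => by simpa using primrec_app hg j) i

theorem primrec_fin_tail {n : ℕ} {f : α → Fin (n + 1) → ℕ} (hf : Primrec f) :
    Primrec fun a => (Fin.tail (f a) : Fin n → ℕ) :=
  primrec_pi fun i => primrec_app hf i.succ

theorem isRecursiveOperator_iff {n : ℕ} {Ψ : (ℕ →. ℕ) → ((Fin (n + 1) → ℕ) →. ℕ)} :
    IsRecursiveOperator Ψ ↔
      UniformEnum PFun.graph fun φ (p : (Fin (n + 1) → ℕ) × ℕ) => p.2 ∈ Ψ φ p.1 :=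
  ⟨fun ⟨W, hW, h⟩ => ⟨W, hW, fun φ p => by rw [← h]; rfl⟩,
    fun ⟨W, hW, h⟩ => ⟨W, hW, fun φ => Set.ext fun p => h φ p⟩⟩

theorem mem_subst {n m : ℕ} {f : (Fin (m + 1) → ℕ) →. ℕ} {g : Fin (m + 1) → (Fin (n + 1) → ℕ) →. ℕ}
    {v : Fin (n + 1) → ℕ} {y : ℕ} :
    y ∈ subst f g v ↔ ∃ u, y ∈ f u ∧ ∀ i, u i ∈ g i v := by
  refine Part.mem_bind_iff.trans ⟨?_, ?_⟩
  · rintro ⟨u, ⟨h, rfl⟩, hy⟩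
    exact ⟨_, hy, fun i => Part.get_mem _⟩
  · rintro ⟨u, hy, hu⟩
    exact ⟨u, ⟨fun i => (hu i).fst, funext fun i => (hu i).snd⟩, hy⟩

theorem isRecursiveOperator_subst {n m : ℕ} {Ψ : (ℕ →. ℕ) → ((Fin (m + 1) → ℕ) →. ℕ)}
    {Θ : Fin (m + 1) → (ℕ →. ℕ) → ((Fin (n + 1) → ℕ) →. ℕ)} (hΨ : IsRecursiveOperator Ψ)
    (hΘ : ∀ i, IsRecursiveOperator (Θ i)) :
    IsRecursiveOperator fun φ => subst (Ψ φ) fun i => Θ i φ := by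
  simp only [isRecursiveOperator_iff] at *
  refine (UniformEnum.exists' (γ := Fin (m + 1) → ℕ)
    (P := fun φ (p : ((Fin (n + 1) → ℕ) × ℕ) × (Fin (m + 1) → ℕ)) =>
      p.1.2 ∈ Ψ φ p.2 ∧ ∀ i, p.2 i ∈ Θ i φ p.1.1) (UniformEnum.and ?_ (UniformEnum.forall_fin
        fun i => ?_))).of_iff fun φ p =>
          (mem_subst (f := Ψ φ) (g := fun i => Θ i φ) (v := p.1) (y := p.2)).symm
  · exact hΨ.comp (f := fun p : ((Fin (n + 1) → ℕ) × ℕ) × (Fin (m + 1) → ℕ) => (p.2, p.1.2))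
      (Primrec.pair Primrec.snd (Primrec.snd.comp Primrec.fst)).to_comp
  · exact (hΘ i).comp (f := fun p : ((Fin (n + 1) → ℕ) × ℕ) × (Fin (m + 1) → ℕ) => (p.1.1, p.2 i))
      (Primrec.pair (Primrec.fst.comp Primrec.fst) (primrec_app Primrec.snd i)).to_comp

/-- A value of a recursion is witnessed by the list of intermediate values, which turns recursion
into an existential and a bounded universal quantifier. As `getD` is total, the length of the list
needs no control: only entries up to `n` matter. -/
theorem mem_rec_bind_iff (a : Part ℕ) (h : ℕ → ℕ →. ℕ) (n y : ℕ) :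
    y ∈ Nat.rec (motive := fun _ => Part ℕ) a (fun k ih => ih.bind (h k)) n ↔
      ∃ l : List ℕ, (l.getD 0 0 ∈ a ∧ ∀ k < n, l.getD (k + 1) 0 ∈ h k (l.getD k 0)) ∧
        l.getD n 0 = y := by
  have key : ∀ n y, y ∈ Nat.rec (motive := fun _ => Part ℕ) a (fun k ih => ih.bind (h k)) n ↔
      ∃ s : ℕ → ℕ, (s 0 ∈ a ∧ ∀ k < n, s (k + 1) ∈ h k (s k)) ∧ s n = y := by
    intro n
    induction n with
    | zero => exact fun y => ⟨fun hy => ⟨fun _ => y, by simpa using hy⟩,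
        fun ⟨s, hs, e⟩ => e ▸ hs.1⟩
    | succ n ih =>
      intro y
      refine (Part.mem_bind_iff.trans (exists_congr fun z => and_congr_left' (ih z))).trans ⟨?_, ?_⟩
      · rintro ⟨z, ⟨s, ⟨h0, hs⟩, rfl⟩, hy⟩
        refine ⟨Function.update s (n + 1) y, ⟨by simpa using h0, fun k hk => ?_⟩, by simp⟩
        rcases Nat.lt_succ_iff_lt_or_eq.1 hk with hk | rfl
        · rw [Function.update_of_ne (by omega), Function.update_of_ne (by omega)]
          exact hs k hk
        · rw [Function.update_self, Function.update_of_ne (by omega)]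
          exact hy
      · rintro ⟨s, ⟨h0, hs⟩, rfl⟩
        exact ⟨s n, ⟨s, ⟨h0, fun k hk => hs k (by omega)⟩, rfl⟩, hs n (by omega)⟩
  rw [key]
  constructor
  · rintro ⟨s, ⟨h0, hs⟩, rfl⟩
    have e : ∀ k ≤ n, ((List.range (n + 1)).map s).getD k 0 = s k := fun k hk => by
      simp [List.getD_eq_getElem?_getD, List.getElem?_range (show k < n + 1 by omega)]
    refine ⟨(List.range (n + 1)).map s, ⟨?_, fun k hk => ?_⟩, e n le_rfl⟩
    · rwa [e 0 (Nat.zero_le n)]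
    · rw [e k (by omega), e (k + 1) (by omega)]
      exact hs k hk
  · rintro ⟨l, hl⟩
    exact ⟨fun k => l.getD k 0, hl⟩

/-- The common part of both forms of primitive recursion: recursion that starts from the value
`Ψ φ` and continues with `Θ φ`, where parameters are read off by primitive recursive functions. -/
theorem uniformEnum_rec {β γ δ : Type} [Primcodable β] [Primcodable γ] [Primcodable δ]
    {Ψ : (ℕ →. ℕ) → (γ →. ℕ)} {Θ : (ℕ →. ℕ) → (δ →. ℕ)}
    (hΨ : UniformEnum PFun.graph fun φ (p : γ × ℕ) => p.2 ∈ Ψ φ p.1)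
    (hΘ : UniformEnum PFun.graph fun φ (p : δ × ℕ) => p.2 ∈ Θ φ p.1)
    {len : β → ℕ} {start : β → γ} {step : β → ℕ → ℕ → δ} (hlen : Primrec len)
    (hstart : Primrec start) (hstep : Primrec fun p : β × ℕ × ℕ => step p.1 p.2.1 p.2.2) :
    UniformEnum PFun.graph fun φ (p : β × ℕ) =>
      p.2 ∈ Nat.rec (motive := fun _ => Part ℕ) (Ψ φ (start p.1))
        (fun k ih => ih.bind fun z => Θ φ (step p.1 k z)) (len p.1) := by
  have get : ∀ {σ : Type} [Primcodable σ] {l : σ → List ℕ} {k : σ → ℕ}, Primrec l → Primrec k →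
      Primrec fun x => (l x).getD (k x) 0 := fun hl hk => (Primrec.list_getD 0).comp hl hk
  refine (UniformEnum.exists' (γ := List ℕ) (P := fun φ (p : (β × ℕ) × List ℕ) =>
      (p.2.getD 0 0 ∈ Ψ φ (start p.1.1) ∧
        ∀ k < len p.1.1, p.2.getD (k + 1) 0 ∈ Θ φ (step p.1.1 k (p.2.getD k 0))) ∧
      p.2.getD (len p.1.1) 0 = p.1.2)
    (UniformEnum.and (UniformEnum.and ?_ ?_) ?_)).of_iff fun φ p =>
      (mem_rec_bind_iff (Ψ φ (start p.1)) (fun k z => Θ φ (step p.1 k z)) (len p.1) p.2).symm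
  · exact hΨ.comp (f := fun p : (β × ℕ) × List ℕ => (start p.1.1, p.2.getD 0 0))
      (Primrec.pair (hstart.comp (Primrec.fst.comp Primrec.fst))
        (get Primrec.snd (Primrec.const 0))).to_comp
  · refine UniformEnum.forall_lt (P := fun φ (q : ((β × ℕ) × List ℕ) × ℕ) =>
        q.1.2.getD (q.2 + 1) 0 ∈ Θ φ (step q.1.1.1 q.2 (q.1.2.getD q.2 0))) ?_
      (hlen.comp (Primrec.fst.comp Primrec.fst))
    refine hΘ.comp (f := fun q : ((β × ℕ) × List ℕ) × ℕ =>
      (step q.1.1.1 q.2 (q.1.2.getD q.2 0), q.1.2.getD (q.2 + 1) 0)) (Primrec.to_comp ?_)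
    have hl : Primrec fun q : ((β × ℕ) × List ℕ) × ℕ => q.1.2 := Primrec.snd.comp Primrec.fst
    exact Primrec.pair
      (hstep.comp (Primrec.pair (Primrec.fst.comp (Primrec.fst.comp Primrec.fst))
        (Primrec.pair Primrec.snd (get hl Primrec.snd))))
      (get hl (Primrec.succ.comp Primrec.snd))
  · exact UniformEnum.of_rePred (rePred_of_primrecPred (Primrec.eq.comp
      (get Primrec.snd (hlen.comp (Primrec.fst.comp Primrec.fst)))
      (Primrec.snd.comp Primrec.fst)))

theorem isRecursiveOperator_primRec {n : ℕ} {Ψ : (ℕ →. ℕ) → ((Fin (n + 1) → ℕ) →. ℕ)}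
    {Θ : (ℕ →. ℕ) → ((Fin (n + 3) → ℕ) →. ℕ)} (hΨ : IsRecursiveOperator Ψ)
    (hΘ : IsRecursiveOperator Θ) : IsRecursiveOperator fun φ => primRec (Ψ φ) (Θ φ) := by
  rw [isRecursiveOperator_iff] at *
  exact uniformEnum_rec hΨ hΘ (len := fun w : Fin (n + 2) → ℕ => w 0) (start := Fin.tail)
    (step := fun w k z => Fin.cons k (Fin.cons z (Fin.tail w : Fin (n + 1) → ℕ) : Fin (n + 2) → ℕ))
    (primrec_app Primrec.id 0) (primrec_fin_tail Primrec.id)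
    (primrec_fin_cons (Primrec.fst.comp Primrec.snd)
      (primrec_fin_cons (Primrec.snd.comp Primrec.snd) (primrec_fin_tail Primrec.fst)))

theorem isRecursiveOperator_primRec₀ (c : ℕ) {Θ : (ℕ →. ℕ) → ((Fin 2 → ℕ) →. ℕ)}
    (hΘ : IsRecursiveOperator Θ) : IsRecursiveOperator fun φ => primRec₀ c (Θ φ) := by
  rw [isRecursiveOperator_iff] at *
  refine uniformEnum_rec (Ψ := fun _ (_ : ℕ) => Part.some c) ?_ hΘ
    (len := fun w : Fin 1 → ℕ => w 0) (start := fun _ => 0) (step := fun _ k z => ![k, z])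
    (primrec_app Primrec.id 0) (Primrec.const 0) ?_
  · exact (UniformEnum.of_rePred (rePred_of_primrecPred
      (Primrec.eq.comp Primrec.snd (Primrec.const c)))).of_iff fun φ p => Part.mem_some_iff.symm
  · refine primrec_pi fun i => ?_
    fin_cases i
    · exact Primrec.fst.comp Primrec.snd
    · exact Primrec.snd.comp Primrec.snd

/-- Nonvanishing is written positively, as having some value `z + 1`, because enumeration operators
can use only positive information. -/
theorem mem_mu {n : ℕ} {f : (Fin (n + 2) → ℕ) →. ℕ} {v : Fin (n + 1) → ℕ} {y : ℕ} :
    y ∈ mu f v ↔ 0 ∈ f (Fin.cons y v : Fin (n + 2) → ℕ) ∧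
      ∀ k < y, ∃ z, z + 1 ∈ f (Fin.cons k v : Fin (n + 2) → ℕ) := by
  refine Nat.mem_rfind.trans (and_congr (by simp) (forall₂_congr fun k _ => ?_))
  simp only [Part.mem_map_iff, decide_eq_false_iff_not]
  exact ⟨fun ⟨z, hz, h0⟩ => ⟨z - 1, by rwa [Nat.sub_add_cancel (Nat.pos_of_ne_zero h0)]⟩,
    fun ⟨z, hz⟩ => ⟨_, hz, by omega⟩⟩

theorem isRecursiveOperator_mu {n : ℕ} {Ψ : (ℕ →. ℕ) → ((Fin (n + 2) → ℕ) →. ℕ)}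
    (hΨ : IsRecursiveOperator Ψ) : IsRecursiveOperator fun φ => mu (Ψ φ) := by
  rw [isRecursiveOperator_iff] at *
  refine (UniformEnum.and (P := fun φ (p : (Fin (n + 1) → ℕ) × ℕ) =>
      0 ∈ Ψ φ (Fin.cons p.2 p.1 : Fin (n + 2) → ℕ)) ?_
    (UniformEnum.forall_lt (f := Prod.snd) (P := fun φ (q : ((Fin (n + 1) → ℕ) × ℕ) × ℕ) =>
      ∃ z, z + 1 ∈ Ψ φ (Fin.cons q.2 q.1.1 : Fin (n + 2) → ℕ))
      (UniformEnum.exists' (P := fun φ (r : (((Fin (n + 1) → ℕ) × ℕ) × ℕ) × ℕ) =>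
        r.2 + 1 ∈ Ψ φ (Fin.cons r.1.2 r.1.1.1 : Fin (n + 2) → ℕ)) ?_)
      Primrec.snd)).of_iff fun φ p => (mem_mu (f := Ψ φ)).symm
  · exact hΨ.comp (f := fun p : (Fin (n + 1) → ℕ) × ℕ =>
        ((Fin.cons p.2 p.1 : Fin (n + 2) → ℕ), 0))
      (Primrec.pair (primrec_fin_cons Primrec.snd Primrec.fst) (Primrec.const 0)).to_comp
  · exact hΨ.comp (f := fun r : (((Fin (n + 1) → ℕ) × ℕ) × ℕ) × ℕ =>
        ((Fin.cons r.1.2 r.1.1.1 : Fin (n + 2) → ℕ), r.2 + 1))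
      (Primrec.pair (primrec_fin_cons (Primrec.snd.comp Primrec.fst)
        (Primrec.fst.comp (Primrec.fst.comp Primrec.fst)))
        (Primrec.succ.comp Primrec.snd)).to_comp

theorem closureProperties_operatorClass (ψ : ℕ →. ℕ) : ClosureProperties (operatorClass ψ) where
  partrec f hf := ⟨fun _ => f, isRecursiveOperator_iff.2 (UniformEnum.of_rePred (rePred_graph hf)),
    rfl⟩
  subst := by
    rintro n m _ g ⟨Ψ, hΨ, rfl⟩ hg
    choose Θ hΘ hg using hg
    obtain rfl : g = fun i => Θ i ψ := funext hg
    exact ⟨_, isRecursiveOperator_subst hΨ hΘ, rfl⟩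
  primRec := by
    rintro n _ _ ⟨Ψ, hΨ, rfl⟩ ⟨Θ, hΘ, rfl⟩
    exact ⟨_, isRecursiveOperator_primRec hΨ hΘ, rfl⟩
  primRec₀ := by
    rintro c _ ⟨Θ, hΘ, rfl⟩
    exact ⟨_, isRecursiveOperator_primRec₀ c hΘ, rfl⟩
  mu := by
    rintro n _ ⟨Ψ, hΨ, rfl⟩
    exact ⟨_, isRecursiveOperator_mu hΨ, rfl⟩

end OperatorClass

/-! ### A universal recursive operator -/

section Universal

open Nat.Partrec (Code)
open Encodable

/-- The axioms of enumeration operators with values that are sets of pairs of numbers. -/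
abbrev OperatorAxiom : Type := List (ℕ × ℕ) × (ℕ × ℕ)

/-- The `s`-th step of the enumeration of the `e`-th recursively enumerable set of axioms. -/
def axiomAt (e s : ℕ) : Option OperatorAxiom :=
  (Code.evaln s.unpair.1 (Denumerable.ofNat Code e) s.unpair.2).bind fun _ => decode s.unpair.2

/-- The axioms enumerated before step `s`. -/
def axiomsBefore (e s : ℕ) : List OperatorAxiom :=
  (List.range s).filterMap (axiomAt e)

/-- The pairs in the list belong to the graph of a partial function. -/
def Consistent (D : List (ℕ × ℕ)) : Prop :=
  ∀ a ∈ D, ∀ b ∈ D, a.1 ≠ b.1 ∨ a.2 = b.2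

/-- Two axioms can give different values at the same argument for some partial function. -/
def Conflict (w w' : OperatorAxiom) : Prop :=
  w.2.1 = w'.2.1 ∧ w.2.2 ≠ w'.2.2 ∧ Consistent (w.1 ++ w'.1)

/-- The axiom `w` is enumerated at step `s`, and it has no conflict with earlier axioms. -/
def Kept (e : ℕ) (w : OperatorAxiom) (s : ℕ) : Prop :=
  axiomAt e s = some w ∧ ∀ w' ∈ axiomsBefore e s, ¬ Conflict w' w

theorem primrec_axiomAt : Primrec₂ axiomAt := by
  have hs : Primrec fun p : ℕ × ℕ => p.2.unpair := Primrec.unpair.comp Primrec.snd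
  refine Primrec.option_bind (Code.primrec_evaln.comp (Primrec.pair (Primrec.pair
    (Primrec.fst.comp hs) ((Primrec.ofNat Code).comp Primrec.fst)) (Primrec.snd.comp hs))) ?_
  exact Primrec.decode.comp (Primrec.snd.comp (hs.comp Primrec.fst))

theorem primrec_axiomsBefore : Primrec₂ axiomsBefore :=
  Primrec.listFilterMap (Primrec.list_range.comp Primrec.snd)
    (primrec_axiomAt.comp (Primrec.fst.comp Primrec.fst) Primrec.snd)

theorem primrecPred_consistent : PrimrecPred Consistent := by
  have h1 : PrimrecRel fun b a : ℕ × ℕ => a.1 ≠ b.1 ∨ a.2 = b.2 :=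
    PrimrecPred.or
      (PrimrecPred.not (Primrec.eq.comp (Primrec.fst.comp Primrec.snd)
        (Primrec.fst.comp Primrec.fst)))
      (Primrec.eq.comp (Primrec.snd.comp Primrec.snd) (Primrec.snd.comp Primrec.fst))
  have h2 : PrimrecRel fun (a : ℕ × ℕ) (D : List (ℕ × ℕ)) => ∀ b ∈ D, a.1 ≠ b.1 ∨ a.2 = b.2 :=
    h1.forall_mem_list.comp Primrec.snd Primrec.fst
  exact h2.forall_mem_list.comp Primrec.id Primrec.id

theorem primrecRel_conflict : PrimrecRel Conflict := by
  have h1 : Primrec fun p : OperatorAxiom × OperatorAxiom => p.1.2 :=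
    Primrec.snd.comp Primrec.fst
  have h2 : Primrec fun p : OperatorAxiom × OperatorAxiom => p.2.2 :=
    Primrec.snd.comp Primrec.snd
  refine PrimrecPred.and (Primrec.eq.comp (Primrec.fst.comp h1) (Primrec.fst.comp h2))
    (PrimrecPred.and (PrimrecPred.not (Primrec.eq.comp (Primrec.snd.comp h1)
      (Primrec.snd.comp h2))) (primrecPred_consistent.comp ?_))
  exact Primrec.list_append.comp (Primrec.fst.comp Primrec.fst) (Primrec.fst.comp Primrec.snd)

/-- Only the finitely many earlier axioms are compared, kept or not, and consistency of a list is
decidable; hence the filtered axioms are r.e. uniformly in `e`. -/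
theorem primrecRel_kept : PrimrecRel fun (p : ℕ × OperatorAxiom) s => Kept p.1 p.2 s := by
  have he : Primrec fun x : (ℕ × OperatorAxiom) × ℕ => x.1.1 := Primrec.fst.comp Primrec.fst
  refine PrimrecPred.and (Primrec.eq.comp (primrec_axiomAt.comp he Primrec.snd)
    (Primrec.option_some.comp (Primrec.snd.comp Primrec.fst))) ?_
  have h1 : PrimrecRel fun w' w => ¬ Conflict w' w := PrimrecPred.not primrecRel_conflict
  exact h1.forall_mem_list.comp (primrec_axiomsBefore.comp he Primrec.snd)
    (Primrec.snd.comp Primrec.fst)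

theorem consistent_of_subset_graph {φ : ℕ →. ℕ} {D : List (ℕ × ℕ)} (h : ∀ a ∈ D, a ∈ φ.graph) :
    Consistent D := by
  intro a ha b hb
  refine or_iff_not_imp_left.2 fun e => ?_
  have ha' : a.2 ∈ φ a.1 := h a ha
  have hb' : b.2 ∈ φ b.1 := h b hb
  rw [not_not.1 e] at ha'
  exact Part.mem_unique ha' hb'

/-- The relation `P` as a partial function. -/
noncomputable def ofRel {α : Type} (P : α → ℕ → Prop) : α →. ℕ :=
  fun a => ⟨∃ y, P a y, fun h => h.choose⟩

theorem mem_ofRel {α : Type} {P : α → ℕ → Prop} (h : ∀ a y z, P a y → P a z → y = z) {a : α}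
    {y : ℕ} : y ∈ ofRel P a ↔ P a y :=
  ⟨fun ⟨hd, e⟩ => e ▸ hd.choose_spec, fun hy => ⟨⟨y, hy⟩, h a _ _ (Exists.choose_spec _) hy⟩⟩

theorem subset_graph_of_consistent {D : List (ℕ × ℕ)} (hD : Consistent D) :
    ∃ φ : ℕ →. ℕ, ∀ a ∈ D, a ∈ φ.graph := by
  refine ⟨ofRel fun x y => (x, y) ∈ D, fun a ha => ?_⟩
  refine (mem_ofRel fun x y z hy hz => ?_).2 ha
  simpa using hD _ hy _ hz

/-- The graph of the value of the universal operator at `φ`. -/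
def universalRel (φ : ℕ →. ℕ) (p : ℕ × ℕ) (y : ℕ) : Prop :=
  ∃ D : List (ℕ × ℕ), (∃ s, Kept p.1 (D, (p.2, y)) s) ∧ ∀ a ∈ D, a ∈ φ.graph

/-- Two kept axioms that apply to the same `φ` have jointly consistent premises; if their values
differed, the earlier one would have excluded the later. -/
theorem universalRel_unique {φ : ℕ →. ℕ} (p : ℕ × ℕ) (y z : ℕ) (hy : universalRel φ p y)
    (hz : universalRel φ p z) : y = z := by
  have key : ∀ {y z s t : ℕ} {D E : List (ℕ × ℕ)}, Kept p.1 (D, (p.2, y)) s →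
      Kept p.1 (E, (p.2, z)) t → (∀ a ∈ D, a ∈ φ.graph) → (∀ a ∈ E, a ∈ φ.graph) → s < t →
      y = z := by
    intro y z s t D E hs ht hD hE hst
    by_contra hne
    refine ht.2 _ (List.mem_filterMap.2 ⟨s, List.mem_range.2 hst, hs.1⟩) ⟨rfl, hne, ?_⟩
    exact consistent_of_subset_graph fun a ha => (List.mem_append.1 ha).elim (hD a) (hE a)
  obtain ⟨D, ⟨s, hs⟩, hD⟩ := hy
  obtain ⟨E, ⟨t, ht⟩, hE⟩ := hz
  rcases lt_trichotomy s t with h | rfl | h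
  · exact key hs ht hD hE h
  · have := hs.1.symm.trans ht.1
    simp only [Option.some.injEq, Prod.mk.injEq] at this
    exact this.2.2
  · exact (key ht hs hE hD h).symm

theorem uniformEnum_universalRel :
    UniformEnum PFun.graph fun φ (q : (ℕ × ℕ) × ℕ) => universalRel φ q.1 q.2 := by
  refine ⟨{x | ∃ s, Kept x.2.1.1 (x.1, (x.2.1.2, x.2.2)) s}, ?_, fun φ q => Iff.rfl⟩
  refine rePred_exists_nat (q := fun (x : List (ℕ × ℕ) × ((ℕ × ℕ) × ℕ)) s =>
    Kept x.2.1.1 (x.1, (x.2.1.2, x.2.2)) s) (primrecRel_kept.comp (Primrec.pair ?_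
      (Primrec.pair ?_ (Primrec.pair ?_ ?_))) Primrec.snd)
  · exact Primrec.fst.comp (Primrec.fst.comp (Primrec.snd.comp Primrec.fst))
  · exact Primrec.fst.comp Primrec.fst
  · exact Primrec.snd.comp (Primrec.fst.comp (Primrec.snd.comp Primrec.fst))
  · exact Primrec.snd.comp (Primrec.snd.comp Primrec.fst)

theorem exists_axiomAt {W : Set OperatorAxiom} (hW : REPred fun w => w ∈ W) :
    ∃ e, ∀ w, w ∈ W ↔ ∃ s, axiomAt e s = some w := by
  obtain ⟨c, hc⟩ := exists_code_of_rePred hW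
  refine ⟨encode c, fun w => ?_⟩
  simp only [axiomAt, Denumerable.ofNat_encode, Option.bind_eq_some_iff]
  constructor
  · intro hw
    obtain ⟨y, hy⟩ := Part.dom_iff_mem.1 ((hc (encode w)).2 ⟨w, encodek w, hw⟩)
    obtain ⟨k, hk⟩ := Code.evaln_complete.1 hy
    exact ⟨Nat.pair k (encode w), y, by rwa [Nat.unpair_pair], by rw [Nat.unpair_pair, encodek]⟩
  · rintro ⟨s, y, hy, hw⟩
    obtain ⟨w', hw', h⟩ := (hc _).1 (Part.dom_iff_mem.2 ⟨y, Code.evaln_sound hy⟩)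
    rwa [Option.some_injective _ (hw.symm.trans hw')]

/-- Filtering removes nothing here: the joint premises of two conflicting axioms are consistent,
hence lie in the graph of some partial `θ`, and `P θ` would take two values at one point. -/
theorem exists_universalRel_iff {P : (ℕ →. ℕ) → ℕ →. ℕ}
    (hP : UniformEnum PFun.graph fun φ (q : ℕ × ℕ) => q.2 ∈ P φ q.1) :
    ∃ e, ∀ φ x y, universalRel φ (e, x) y ↔ y ∈ P φ x := by
  obtain ⟨W, hW, h⟩ := hP
  obtain ⟨e, he⟩ := exists_axiomAt hW
  refine ⟨e, fun φ x y => (exists_congr fun D => and_congr_left fun _ => ?_).trans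
    (h φ (x, y)).symm⟩
  rw [he]
  refine exists_congr fun s => ⟨And.left, fun hs => ⟨hs, ?_⟩⟩
  rintro ⟨E, x', z⟩ hw ⟨hx, hne, hc⟩
  obtain ⟨t, -, ht⟩ := List.mem_filterMap.1 hw
  obtain ⟨θ, hθ⟩ := subset_graph_of_consistent hc
  obtain rfl : x' = x := hx
  have h1 : z ∈ P θ x' :=
    (h θ (x', z)).2 ⟨E, (he _).2 ⟨t, ht⟩, fun a ha => hθ a (List.mem_append_left _ ha)⟩
  have h2 : y ∈ P θ x' :=
    (h θ (x', y)).2 ⟨D, (he _).2 ⟨s, hs⟩, fun a ha => hθ a (List.mem_append_right _ ha)⟩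
  exact hne (Part.mem_unique h1 h2)

theorem programsAxiom_operatorClass (ψ : ℕ →. ℕ) : ProgramsAxiom (operatorClass ψ) := by
  refine ⟨fun e x => ofRel (universalRel ψ) (e, x),
    ⟨fun φ v => ofRel (universalRel φ) (v 0, v 1), isRecursiveOperator_iff.2 ?_, rfl⟩, ?_⟩
  · refine (uniformEnum_universalRel.comp (f := fun p : (Fin 2 → ℕ) × ℕ =>
      ((p.1 0, p.1 1), p.2)) (Primrec.pair (Primrec.pair (primrec_app Primrec.fst 0)
        (primrec_app Primrec.fst 1)) Primrec.snd).to_comp).of_iff fun φ p => ?_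
    exact (mem_ofRel universalRel_unique).symm
  · rintro f ⟨Ψ, hΨ, hf⟩
    obtain ⟨e, he⟩ := exists_universalRel_iff (P := fun φ x => Ψ φ fun _ => x)
      ((isRecursiveOperator_iff.1 hΨ).comp (f := fun q : ℕ × ℕ => ((fun _ : Fin 1 => q.1), q.2))
        (Primrec.pair (primrec_pi fun _ => Primrec.fst) Primrec.snd).to_comp)
    refine ⟨e, funext fun x => Part.ext fun y => (mem_ofRel universalRel_unique).trans ?_⟩
    rw [he, ← hf]
    rfl

end Universal

/-! ### Existence of quasi-minimal functions -/

section QuasiMinimal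

/-- The function with value `0` on the set with characteristic function `A`, undefined outside. -/
def semiChar (A : ℕ → Bool) : ℕ →. ℕ := fun x => Part.assert (A x = true) fun _ => Part.some 0

theorem mem_graph_semiChar {A : ℕ → Bool} {a : ℕ × ℕ} :
    a ∈ (semiChar A).graph ↔ A a.1 = true ∧ a.2 = 0 := by
  refine Part.mem_assert_iff.trans ?_
  simp

/-- The sets from whose semicharacteristic function `W` enumerates a multivalued relation. -/
def multivaluedSet (W : Set (List (ℕ × ℕ) × (ℕ × ℕ))) : Set (ℕ → Bool) :=
  {A | ∃ x y z, y ≠ z ∧ (x, y) ∈ enumOperator W (semiChar A).graph ∧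
    (x, z) ∈ enumOperator W (semiChar A).graph}

/-- An axiom has finitely many premises, so its applicability depends on finitely many coordinates
of `A`. -/
theorem isOpen_enumOperator_semiChar (W : Set (List (ℕ × ℕ) × (ℕ × ℕ))) (b : ℕ × ℕ) :
    IsOpen {A : ℕ → Bool | b ∈ enumOperator W (semiChar A).graph} := by
  have h : {A : ℕ → Bool | b ∈ enumOperator W (semiChar A).graph} =
      ⋃ D ∈ {D | (D, b) ∈ W}, ⋂ a ∈ {a | a ∈ D}, {A | A a.1 = true ∧ a.2 = 0} := by
    ext A
    simp [enumOperator, mem_graph_semiChar]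
  rw [h]
  refine isOpen_biUnion fun D _ => (List.finite_toSet D).isOpen_biInter fun a _ => ?_
  have h1 : IsOpen {A : ℕ → Bool | A a.1 = true} :=
    (isOpen_discrete ({true} : Set Bool)).preimage (continuous_apply (A := fun _ => Bool) a.1)
  exact h1.and isOpen_const

theorem isOpen_multivaluedSet (W : Set (List (ℕ × ℕ) × (ℕ × ℕ))) :
    IsOpen (multivaluedSet W) := by
  have h : multivaluedSet W = ⋃ (x : ℕ) (y : ℕ) (z : ℕ) (_ : y ≠ z),
      {A | (x, y) ∈ enumOperator W (semiChar A).graph} ∩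
        {A | (x, z) ∈ enumOperator W (semiChar A).graph} := by
    ext A
    simp only [multivaluedSet, Set.mem_ofPred_eq, Set.mem_iUnion, Set.mem_inter_iff, exists_prop]
  rw [h]
  exact isOpen_iUnion fun x => isOpen_iUnion fun y => isOpen_iUnion fun z => isOpen_iUnion fun _ =>
    (isOpen_enumOperator_semiChar W _).inter (isOpen_enumOperator_semiChar W _)

theorem exists_cylinder_subset {U : Set (ℕ → Bool)} (hU : IsOpen U) {A : ℕ → Bool} (hA : A ∈ U) :
    ∃ n, PiNat.cylinder A n ⊆ U := by
  obtain ⟨_, ⟨B, n, rfl⟩, hAB, h⟩ :=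
    (PiNat.isTopologicalBasis_cylinders fun _ => Bool).exists_subset_of_mem_open hA hU
  exact ⟨n, by rwa [PiNat.mem_cylinder_iff_eq.1 hAB]⟩

theorem dense_compl_singleton_cantor (A : ℕ → Bool) : Dense ({A}ᶜ : Set (ℕ → Bool)) := by
  refine interior_eq_empty_iff_dense_compl.1 (Set.eq_empty_iff_forall_notMem.2 fun B hB => ?_)
  obtain ⟨n, hn⟩ := exists_cylinder_subset isOpen_interior hB
  have h : ∀ C ∈ PiNat.cylinder B n, C = A := fun C hC =>
    Set.mem_singleton_iff.1 (interior_subset (hn hC))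
  have h1 := (h _ (PiNat.update_mem_cylinder B n (!B n))).trans
    (h B (PiNat.self_mem_cylinder B n)).symm
  simpa using congrFun h1 n

/-- Baire category in Cantor space: countably many singletons and countably many frontiers of open
sets are avoided, each closed with empty interior. -/
theorem exists_generic : ∃ A : ℕ → Bool, (¬ REPred fun x => A x = true) ∧
    ∀ W : Set (List (ℕ × ℕ) × (ℕ × ℕ)), REPred (fun p => p ∈ W) →
      A ∉ frontier (multivaluedSet W) := by
  let S : Set (Set (ℕ → Bool)) :=
    (fun A => {A}ᶜ) '' {A | REPred fun x => A x = true} ∪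
      (fun W => (frontier (multivaluedSet W))ᶜ) '' {W | REPred fun p => p ∈ W}
  have hc : {A : ℕ → Bool | REPred fun x => A x = true}.Countable := by
    refine (countable_setOf_rePred (α := ℕ)).preimage_of_injOn
      (f := fun A : ℕ → Bool => {x | A x = true}) fun A _ B _ h => funext fun x => ?_
    exact Bool.eq_iff_iff.2 (Set.ext_iff.1 h x)
  have hS : Dense (⋂₀ S) := by
    refine dense_sInter_of_isOpen ?_ ((hc.image _).union (countable_setOf_rePred.image _)) ?_
    · rintro _ (⟨A, -, rfl⟩ | ⟨W, -, rfl⟩)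
      · exact isOpen_compl_singleton
      · exact isClosed_frontier.isOpen_compl
    · rintro _ (⟨A, -, rfl⟩ | ⟨W, -, rfl⟩)
      · exact dense_compl_singleton_cantor A
      · rw [← interior_eq_empty_iff_dense_compl, ← frontier_compl]
        exact interior_frontier (isOpen_multivaluedSet W).isClosed_compl
  obtain ⟨A, hA⟩ := hS.nonempty
  refine ⟨A, fun h => hA _ (Or.inl ⟨A, h, rfl⟩) rfl, fun W hW => hA _ (Or.inr ⟨W, hW, rfl⟩)⟩

theorem enumOperator_mono {α β : Type} {W : Set (List α × β)} {X Y : Set α} (h : X ⊆ Y) :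
    enumOperator W X ⊆ enumOperator W Y :=
  fun _ ⟨D, hD, hX⟩ => ⟨D, hD, fun a ha => h (hX a ha)⟩

theorem exists_isQuasiMinimal : ∃ ψ : ℕ →. ℕ, IsQuasiMinimal ψ := by
  obtain ⟨A, hA, hfr⟩ := exists_generic
  refine ⟨semiChar A, fun h => hA (h.dom_re.of_eq fun x => ?_), ?_⟩
  · simp [semiChar, Part.assert]
  rintro g ⟨W, hW, hg⟩
  have hAU : A ∉ multivaluedSet W := by
    rintro ⟨x, y, z, hne, hy, hz⟩
    rw [← hg] at hy hz
    exact hne (Part.mem_unique (o := Part.some (g x)) hy hz)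
  -- Outside the open set and off its frontier, `A` is interior to the complement.
  have hAi : A ∈ interior (multivaluedSet W)ᶜ := by
    rw [interior_compl]
    intro h
    exact hfr W hW ⟨h, fun hi => hAU (interior_subset hi)⟩
  obtain ⟨n, hn⟩ := exists_cylinder_subset isOpen_interior hAi
  -- `B` copies `A` below `n` and is `true` from `n` on, by the default of `getD`; so it stays in
  -- the cylinder, contains `A` and is primitive recursive.
  let B : ℕ → Bool := fun k => ((List.range n).map A).getD k true
  have hB1 : ∀ k < n, B k = A k := fun k hk => by
    simp [B, List.getD_eq_getElem?_getD, List.getElem?_range hk]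
  have hB2 : ∀ k, n ≤ k → B k = true := fun k hk => by
    simp [B, List.getD_eq_getElem?_getD, hk]
  have hBU : B ∉ multivaluedSet W := interior_subset (hn (PiNat.mem_cylinder_iff.2 hB1))
  have hAB : (semiChar A).graph ⊆ (semiChar B).graph := by
    intro a ha
    rw [mem_graph_semiChar] at ha ⊢
    rcases lt_or_ge a.1 n with h | h
    · rwa [hB1 _ h]
    · exact ⟨hB2 _ h, ha.2⟩
  have hre : REPred fun a => a ∈ (semiChar B).graph := by
    refine (rePred_of_primrecPred (PrimrecPred.and (Primrec.eq.comp (?_ : Primrec fun a => B a.1)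
      (Primrec.const true)) (Primrec.eq.comp Primrec.snd (Primrec.const 0)))).of_eq fun a =>
        mem_graph_semiChar.symm
    exact (Primrec.list_getD true).comp (Primrec.const _) Primrec.fst
  refine partrec_of_rePred_graph ((rePred_of_enumReducible ⟨W, hW, rfl⟩ hre).of_eq fun p => ?_)
  -- By monotonicity `W` still enumerates the graph of `g` from `B`; it enumerates nothing more,
  -- since `B` does not make it multivalued.
  have hgB : ∀ x, (x, g x) ∈ enumOperator W (semiChar B).graph := fun x =>
    enumOperator_mono hAB (hg ▸ Part.mem_some (g x))
  refine ⟨fun hp => ?_, fun hp => ?_⟩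
  · by_contra hne
    exact hBU ⟨p.1, p.2, g p.1, fun h => hne (Part.mem_some_iff.2 h), hp, hgB p.1⟩
  · have h : p.2 = g p.1 := Part.mem_some_iff.1 hp
    have := hgB p.1
    rwa [← h] at this

end QuasiMinimal

/-! ### The class obtained from a quasi-minimal function -/

section QuasiMinimalClass

theorem partrec_unary {f : ℕ →. ℕ} : Partrec (unary f) ↔ Partrec f := by
  refine ⟨fun h => ?_, fun h => h.comp (primrec_app Primrec.id 0).to_comp⟩
  exact h.comp (f := unary f) (g := fun (x : ℕ) (_ : Fin 1) => x)
    (primrec_pi fun _ => Primrec.id).to_comp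

theorem unary_injective : Function.Injective unary := fun _ _ h =>
  funext fun x => congrFun h fun _ => x

theorem self_mem_operatorClass (ψ : ℕ →. ℕ) : unary ψ ∈ operatorClass ψ 0 := by
  refine ⟨unary, isRecursiveOperator_iff.2 ?_, rfl⟩
  exact UniformEnum.base.comp (f := fun p : (Fin 1 → ℕ) × ℕ => (p.1 0, p.2))
    (Primrec.pair (primrec_app Primrec.fst 0) Primrec.snd).to_comp

theorem enumReducible_of_mem_operatorClass {ψ f : ℕ →. ℕ} (hf : unary f ∈ operatorClass ψ 0)
    {h : ℕ → ℕ} (hh : Computable h) : 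
    EnumReducible (PFun.graph (α := ℕ) (β := ℕ) fun x => f (h x)) ψ.graph := by
  obtain ⟨Ψ, hΨ, e⟩ := hf
  have := ((isRecursiveOperator_iff.1 hΨ).comp
    (f := fun p : ℕ × ℕ => ((fun _ : Fin 1 => h p.1), p.2))
    (Computable.pair (((primrec_pi fun _ => Primrec.id).to_comp (f := fun x (_ : Fin 1) => x)).comp
      (hh.comp Computable.fst)) Computable.snd)).enumReducible ψ
  rw [← e] at this
  exact this

theorem recursiveIn_comp_computable {α : Type} [Primcodable α] (g : ℕ →. ℕ) {h : α → ℕ}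
    (hh : Computable h) : RecursiveIn {g} fun a => g (h a) := by
  have h1 : Partrec fun n : ℕ => ((Encodable.decode (α := α) n).map h : Part ℕ) :=
    Computable.ofOption (Computable.option_map Computable.decode (hh.comp Computable.snd).to₂)
  have h2 : Nat.RecursiveIn {g} g := .oracle g (Set.mem_singleton g)
  refine Nat.RecursiveIn.of_eq (h2.comp (Partrec.nat_iff.1 h1).recursiveIn) fun n => ?_
  cases (Encodable.decode n : Option α) with
  | none => simpa using show Part.none >>= g = Part.none from Part.bind_none g
  | some a => simpa [Part.map_id'] using show Part.some (h a) >>= g = g (h a) from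
      Part.bind_some (h a) g

theorem recursiveIn_unary (g : ℕ →. ℕ) : RecursiveIn {g} (unary g) :=
  recursiveIn_comp_computable g (primrec_app Primrec.id 0).to_comp

namespace IsQuasiMinimal

variable {ψ : ℕ →. ℕ}

theorem computable_comp (hψ : IsQuasiMinimal ψ) {f : ℕ →. ℕ} (hf : unary f ∈ operatorClass ψ 0) {h g : ℕ → ℕ}
    (hh : Computable h) (hg : ∀ x, g x ∈ f (h x)) : Computable g := by
  refine hψ.2 g ?_
  have := enumReducible_of_mem_operatorClass hf hh
  have e : (fun x => f (h x)) = fun x => Part.some (g x) :=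
    funext fun x => Part.eq_some_iff.2 (hg x)
  rwa [e] at this

theorem partrec_indicatorFun (hψ : IsQuasiMinimal ψ) {A : Set ℕ}
    (hA : unary (indicatorFun A) ∈ operatorClass ψ 0) :
    Partrec (indicatorFun A) :=
  (hψ.computable_comp hA Computable.id (g := A.indicator fun _ => 1) fun _ => Part.mem_some _)

theorem not_isRelativized (hψ : IsQuasiMinimal ψ) : ¬ IsRelativized (operatorClass ψ) := by
  rintro ⟨A, hA⟩
  have h2 := hψ.partrec_indicatorFun ((hA 0 _).2 (recursiveIn_unary _))
  have h3 := (hA 0 _).1 (self_mem_operatorClass ψ)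
  refine hψ.1 (partrec_unary.1 (h3.partrec_of_oracle ?_))
  rintro _ rfl
  exact h2

theorem not_isEnumRelativized (hψ : IsQuasiMinimal ψ) : ¬ IsEnumRelativized (operatorClass ψ) := by
  rintro ⟨A, hA⟩
  have h1 : EnumReducible (unary (indicatorFun A)).graph (indicatorFun A).graph :=
    (UniformEnum.base.comp (G := PFun.graph) (f := fun p : (Fin 1 → ℕ) × ℕ => (p.1 0, p.2))
      (Primrec.pair (primrec_app Primrec.fst 0) Primrec.snd).to_comp).enumReducible _
  have h2 := hψ.partrec_indicatorFun ((hA 0 _).2 h1)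
  have h3 := (hA 0 _).1 (self_mem_operatorClass ψ)
  exact hψ.1 (partrec_unary.1 (partrec_of_rePred_graph
    (rePred_of_enumReducible h3 (rePred_graph h2))))

/-- The indicator of `M` is recursive by quasi-minimality. Composing `α` and `ω` with a recursive
retraction onto `M` makes them total, hence recursive, and the graph of `ψ` becomes the range of a
recursive sequence of pairs. -/
theorem not_computationRecords (hψ : IsQuasiMinimal ψ) : ¬ ComputationRecords (operatorClass ψ) := by
  intro h
  obtain ⟨M, α, ω, hα, hω, hMα, hMω, hM, hrec⟩ := h ψ (self_mem_operatorClass ψ)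
  have hind : Computable (M.indicator fun _ => 1) := hψ.partrec_indicatorFun hM
  rcases M.eq_empty_or_nonempty with rfl | ⟨m₀, hm₀⟩
  · refine hψ.1 (Partrec.none.of_eq fun x => (Part.eq_none_iff.2 fun y hy => ?_).symm)
    obtain ⟨m, hm, -⟩ := (hrec x y).1 hy
    exact hm
  classical
  -- `α` and `ω` are known to be defined only on `M`, so other arguments are sent to the fixed
  -- element `m₀`.
  let e : ℕ → ℕ := fun m => if m ∈ M then m else m₀
  have he : Computable e := by
    refine (Computable.cond (c := fun m => M.indicator (fun _ => 1) m == 1)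
      (Primrec.beq.to_comp.comp hind (Computable.const 1)) Computable.id
      (Computable.const m₀)).of_eq fun m => ?_
    by_cases hm : m ∈ M <;> simp [e, hm]
  have heM : ∀ m, e m ∈ M := fun m => by
    by_cases hm : m ∈ M <;> simp [e, hm, hm₀]
  let a : ℕ → ℕ := fun m => (α (e m)).get (hMα (heM m))
  let o : ℕ → ℕ := fun m => (ω (e m)).get (hMω (heM m))
  have ha : Computable a := hψ.computable_comp hα he fun m => Part.get_mem _
  have ho : Computable o := hψ.computable_comp hω he fun m => Part.get_mem _
  refine hψ.1 (partrec_of_rePred_graph ?_)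
  have hre : REPred fun p : (ℕ × ℕ) × ℕ => (a p.2, o p.2) = p.1 := by
    refine rePred_comp (p := fun q : (ℕ × ℕ) × (ℕ × ℕ) => q.1 = q.2)
      (rePred_of_primrecPred Primrec.eq) (f := fun p : (ℕ × ℕ) × ℕ => ((a p.2, o p.2), p.1)) ?_
    exact Computable.pair (Computable.pair (ha.comp Computable.snd) (ho.comp Computable.snd))
      Computable.fst
  refine (rePred_exists hre).of_eq fun p => ⟨?_, fun hp => ?_⟩
  · rintro ⟨m, hm⟩
    obtain rfl : (a m, o m) = p := hm
    exact (hrec _ _).2 ⟨e m, heM m, Part.get_mem _, Part.get_mem _⟩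
  · obtain ⟨m, hm, h1, h2⟩ := (hrec _ _).1 hp
    have hem : e m = m := if_pos hm
    have h3 : a m ∈ α (e m) := Part.get_mem _
    have h4 : o m ∈ ω (e m) := Part.get_mem _
    rw [hem] at h3 h4
    exact ⟨m, Prod.ext (Part.mem_unique h3 h1) (Part.mem_unique h4 h2)⟩

end IsQuasiMinimal

end QuasiMinimalClass

/-! ### The class of the identity, the constants and all functions of several arguments -/

section IdConst

theorem succ_notMem_idConstClass : unary (fun x => Part.some (x + 1)) ∉ idConstClass 0 := by
  rintro (h | ⟨c, h⟩)
  · simpa using Part.some_inj.1 (congrFun (unary_injective h) 0)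
  · have h0 := Part.some_inj.1 (congrFun (unary_injective h) 0)
    have h1 := Part.some_inj.1 (congrFun (unary_injective h) 1)
    omega

theorem partrec_unary_succ : Partrec (unary fun x => Part.some (x + 1)) :=
  partrec_unary.2 Primrec.succ.to_comp.partrec

theorem not_closureProperties_idConstClass : ¬ ClosureProperties idConstClass := fun h =>
  succ_notMem_idConstClass (h.partrec _ partrec_unary_succ)

theorem not_isRelativized_idConstClass : ¬ IsRelativized idConstClass := fun ⟨_, h⟩ =>
  succ_notMem_idConstClass ((h 0 _).2 partrec_unary_succ.recursiveIn)

theorem not_isEnumRelativized_idConstClass : ¬ IsEnumRelativized idConstClass := fun ⟨A, h⟩ =>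
  succ_notMem_idConstClass ((h 0 _).2 ((UniformEnum.of_rePred (G := PFun.graph)
    (rePred_graph partrec_unary_succ)).enumReducible (indicatorFun A)))

theorem computationRecords_idConstClass : ComputationRecords idConstClass := by
  intro f hf
  have hM : unary (indicatorFun Set.univ) ∈ idConstClass 0 :=
    Or.inr ⟨1, funext fun v => by simp [unary, indicatorFun]⟩
  rcases hf with h | ⟨c, h⟩
  · obtain rfl := unary_injective h
    refine ⟨Set.univ, _, _, Or.inl rfl, Or.inl rfl, fun _ _ => trivial, fun _ _ => trivial, hM,
      fun x y => ?_⟩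
    simp
  · obtain rfl := unary_injective h
    refine ⟨Set.univ, _, _, Or.inl rfl, Or.inr ⟨c, rfl⟩, fun _ _ => trivial, fun _ _ => trivial,
      hM, fun x y => ?_⟩
    simp

theorem programsAxiom_idConstClass : ProgramsAxiom idConstClass := by
  -- Program `0` is the identity and program `c + 1` the constant `c`.
  refine ⟨fun n x => Nat.rec (Part.some x) (fun c _ => Part.some c) n, trivial, ?_⟩
  rintro f (h | ⟨c, h⟩)
  · exact ⟨0, (unary_injective h).symm⟩
  · exact ⟨c + 1, (unary_injective h).symm⟩

end IdConst

/-! ### The class of all partial functions -/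

section AllFunctions

theorem closureProperties_allFunctions : ClosureProperties allFunctions :=
  ⟨fun _ _ => trivial, fun _ _ _ _ => trivial, fun _ _ _ _ => trivial, fun _ _ _ => trivial,
    fun _ _ => trivial⟩

theorem computationRecords_allFunctions : ComputationRecords allFunctions := by
  intro f _
  -- The records are the coded points of the graph of `f`.
  refine ⟨{m | m.unpair.2 ∈ f m.unpair.1}, fun m => Part.some m.unpair.1,
    fun m => Part.some m.unpair.2, trivial, trivial, fun _ _ => trivial, fun _ _ => trivial,
    trivial, fun x y => ⟨fun h => ⟨Nat.pair x y, ?_⟩, ?_⟩⟩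
  · simpa using h
  · rintro ⟨m, hm, hx, hy⟩
    rw [Part.mem_some_iff] at hx hy
    rw [hx, hy]
    exact hm

theorem not_programsAxiom_allFunctions : ¬ ProgramsAxiom allFunctions := by
  rintro ⟨F, -, hF⟩
  obtain ⟨n, hn⟩ := hF (fun x => ⟨¬ (F x x).Dom, fun _ => 0⟩) trivial
  have h : (F n n).Dom ↔ ¬ (F n n).Dom := iff_of_eq (congrArg Part.Dom (congrFun hn n))
  tauto

/-- An enumeration of all unary partial functions would be a universal binary function, already
excluded by diagonalization. -/
theorem not_countable_partialFunctions : ¬ (Set.univ : Set (ℕ →. ℕ)).Countable := by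
  intro h
  obtain ⟨F, hF⟩ := h.exists_eq_range Set.univ_nonempty
  exact not_programsAxiom_allFunctions ⟨F, trivial, fun f _ => by
    have : f ∈ Set.range F := hF ▸ Set.mem_univ f
    exact this⟩

/-- The functions obtained from a function `g` by at most `k` nested operations of the definition
of `Nat.RecursiveIn`. -/
def recursiveInStage (g : ℕ →. ℕ) : ℕ → Set (ℕ →. ℕ)
  | 0 => {fun _ => 0, (Nat.succ : ℕ →. ℕ), fun n => Part.some n.unpair.1,
      fun n => Part.some n.unpair.2, g}
  | k + 1 => recursiveInStage g k ∪
      (Set.image2 (fun f h n => Nat.pair <$> f n <*> h n)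
        (recursiveInStage g k) (recursiveInStage g k) ∪
      (Set.image2 (fun f h n => h n >>= f) (recursiveInStage g k) (recursiveInStage g k) ∪
      (Set.image2 (fun f h p => Nat.rec (motive := fun _ => Part ℕ) (f p.unpair.1)
          (fun y IH => IH >>= fun i => h (Nat.pair p.unpair.1 (Nat.pair y i))) p.unpair.2)
        (recursiveInStage g k) (recursiveInStage g k) ∪
      (fun f a => Nat.rfind fun n => (fun m => decide (m = 0)) <$> f (Nat.pair a n)) ''
        recursiveInStage g k)))

theorem countable_recursiveInStage (g : ℕ →. ℕ) (k : ℕ) : (recursiveInStage g k).Countable := by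
  induction k with
  | zero => exact Set.Countable.insert _ (Set.Countable.insert _ (Set.Countable.insert _
      (Set.Countable.insert _ (Set.countable_singleton g))))
  | succ k ih =>
    exact ih.union ((ih.image2 ih _).union ((ih.image2 ih _).union
      ((ih.image2 ih _).union (ih.image _))))

theorem monotone_recursiveInStage (g : ℕ →. ℕ) : Monotone (recursiveInStage g) :=
  monotone_nat_of_le_succ fun _ => Set.subset_union_left

theorem exists_mem_recursiveInStage {g f : ℕ →. ℕ} (hf : Nat.RecursiveIn {g} f) :
    ∃ k, f ∈ recursiveInStage g k := by
  have mono := monotone_recursiveInStage g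
  induction hf with
  | zero => exact ⟨0, Or.inl rfl⟩
  | succ => exact ⟨0, Or.inr (Or.inl rfl)⟩
  | left => exact ⟨0, Or.inr (Or.inr (Or.inl rfl))⟩
  | right => exact ⟨0, Or.inr (Or.inr (Or.inr (Or.inl rfl)))⟩
  | oracle h hh => exact ⟨0, Or.inr (Or.inr (Or.inr (Or.inr hh)))⟩
  | pair _ _ ihf ihh =>
    obtain ⟨k, hk⟩ := ihf
    obtain ⟨l, hl⟩ := ihh
    exact ⟨max k l + 1, Or.inr (Or.inl ⟨_, mono (le_max_left k l) hk, _,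
      mono (le_max_right k l) hl, rfl⟩)⟩
  | comp _ _ ihf ihh =>
    obtain ⟨k, hk⟩ := ihf
    obtain ⟨l, hl⟩ := ihh
    exact ⟨max k l + 1, Or.inr (Or.inr (Or.inl ⟨_, mono (le_max_left k l) hk, _,
      mono (le_max_right k l) hl, rfl⟩))⟩
  | prec _ _ ihf ihh =>
    obtain ⟨k, hk⟩ := ihf
    obtain ⟨l, hl⟩ := ihh
    exact ⟨max k l + 1, Or.inr (Or.inr (Or.inr (Or.inl ⟨_, mono (le_max_left k l) hk, _,
      mono (le_max_right k l) hl, rfl⟩)))⟩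
  | rfind _ ihf =>
    obtain ⟨k, hk⟩ := ihf
    exact ⟨k + 1, Or.inr (Or.inr (Or.inr (Or.inr ⟨_, hk, rfl⟩)))⟩

theorem countable_setOf_recursiveIn {α σ : Type} [Primcodable α] [Primcodable σ] (g : ℕ →. ℕ) :
    {f : α →. σ | RecursiveIn {g} f}.Countable := by
  -- This is the function on codes through which `RecursiveIn` is defined; its injectivity transfers
  -- countability from functions on `ℕ`.
  let code : (α →. σ) → (ℕ →. ℕ) := fun f n =>
    Part.bind (Encodable.decode (α := α) n) fun a => (f a).map Encodable.encode
  have hcode : Function.Injective code := by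
    intro f h e
    funext a
    have h1 : (f a).map Encodable.encode = (h a).map Encodable.encode := by
      simpa [code] using congrFun e (Encodable.encode a)
    refine Part.ext fun y => ?_
    have h2 := Part.ext_iff.1 h1 (Encodable.encode y)
    simpa using h2
  refine ((Set.countable_iUnion (countable_recursiveInStage g)).preimage hcode).mono fun f hf => ?_
  exact Set.mem_iUnion.2 (exists_mem_recursiveInStage hf)

theorem not_isRelativized_allFunctions : ¬ IsRelativized allFunctions := fun ⟨A, hA⟩ =>
  not_countable_partialFunctions (((countable_setOf_recursiveIn (indicatorFun A)).preimage
    unary_injective).mono fun f _ => (hA 0 (unary f)).1 trivial)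

/-- With the oracle fixed, a reducible graph is determined by an r.e. set `W`, and there are only
countably many of these. -/
theorem not_isEnumRelativized_allFunctions : ¬ IsEnumRelativized allFunctions := by
  rintro ⟨A, hA⟩
  have hinj : Function.Injective fun f : ℕ →. ℕ => (unary f).graph := fun f g h =>
    unary_injective (funext fun v => Part.ext fun y => Set.ext_iff.1 h (v, y))
  refine not_countable_partialFunctions ((((countable_setOf_rePred
    (α := List (ℕ × ℕ) × ((Fin 1 → ℕ) × ℕ))).image
      fun W => enumOperator W (indicatorFun A).graph).preimage hinj).mono fun f _ => ?_)
  obtain ⟨W, hW, h⟩ := (hA 0 (unary f)).1 trivial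
  exact ⟨W, hW, h.symm⟩

end AllFunctions

end RelComp

theorem mainTheorem4 :
    (¬ RelComp.ClosureProperties RelComp.idConstClass ∧
      RelComp.ComputationRecords RelComp.idConstClass ∧
      RelComp.ProgramsAxiom RelComp.idConstClass ∧
      ¬ RelComp.IsRelativized RelComp.idConstClass ∧
      ¬ RelComp.IsEnumRelativized RelComp.idConstClass) ∧
    ((∃ ψ : ℕ →. ℕ, RelComp.IsQuasiMinimal ψ) ∧
      ∀ ψ : ℕ →. ℕ, RelComp.IsQuasiMinimal ψ →
        RelComp.ClosureProperties (RelComp.operatorClass ψ) ∧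
        ¬ RelComp.ComputationRecords (RelComp.operatorClass ψ) ∧
        RelComp.ProgramsAxiom (RelComp.operatorClass ψ) ∧
        ¬ RelComp.IsRelativized (RelComp.operatorClass ψ) ∧
        ¬ RelComp.IsEnumRelativized (RelComp.operatorClass ψ)) ∧
    (RelComp.ClosureProperties RelComp.allFunctions ∧
      RelComp.ComputationRecords RelComp.allFunctions ∧
      ¬ RelComp.ProgramsAxiom RelComp.allFunctions ∧
      ¬ RelComp.IsRelativized RelComp.allFunctions ∧
      ¬ RelComp.IsEnumRelativized RelComp.allFunctions) := by
  open RelComp in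
  exact ⟨⟨not_closureProperties_idConstClass, computationRecords_idConstClass,
      programsAxiom_idConstClass, not_isRelativized_idConstClass,
      not_isEnumRelativized_idConstClass⟩,
    ⟨exists_isQuasiMinimal, fun ψ hψ => ⟨closureProperties_operatorClass ψ,
      hψ.not_computationRecords, programsAxiom_operatorClass ψ, hψ.not_isRelativized,
      hψ.not_isEnumRelativized⟩⟩,
    closureProperties_allFunctions, computationRecords_allFunctions,
    not_programsAxiom_allFunctions, not_isRelativized_allFunctions,
    not_isEnumRelativized_allFunctions⟩
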